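/- Let $d\in\mathbb{N}_0$ and let $\mathbb{R}_*=\mathbb{R}\setminus\{0\}$. Write $\mathscr{D}(\mathbb{R}^d)$ for the space of (real- or complex-valued) test functions, i.e. $C^\infty$ functions with compact support, and $\mathscr{D}'(\mathbb{R}^d)$ for the space of distributions, i.e. continuous linear forms on it (over the same scalar field). For $x,y\in\mathbb{R}^d$ put $xy=(x_1y_1,\dots,x_dy_d)$, and for $\varepsilon>0$ put $W_\varepsilon=\{x\in\mathbb{R}^d : |x_j|\ge\varepsilon \text{ for all } j\}$. Let $\theta_j=x_j\partial_j$ and $\theta^\beta=\theta_1^{\beta_1}\cdots\theta_d^{\beta_d}$ for $\beta\in\mathbb{N}_0^d$, acting on distributions. Let $\mathscr{O}_H'(\mathbb{R}^d)$ be the set of all $T\in\mathscr{D}'(\mathbb{R}^d)$ such that for every $k\in\mathbb{N}_0$ there are finitely many functions $t_\beta$ with $(1+|x|^2)^{k/2}t_\beta\in L_\infty(\mathbb{R}^d)$ and $T=\sum_\beta\theta^\beta t_\beta$. Let $\mathscr{D}_H(\mathbb{R}^d)$ be the set of all $T\in\mathscr{D}'(\mathbb{R}^d)$ such that for every $\varphi\in\mathscr{D}(\mathbb{R}^d)$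 the function $y\mapsto T_x\varphi(xy)$, $y\in\mathbb{R}_*^d$, is the restriction of a function in $\mathscr{D}(\mathbb{R}^d)$. Theorem. Let $T\in\mathscr{O}_H'(\mathbb{R}^d)$. Then: 1. For every $\varphi\in\mathscr{D}(\mathbb{R}^d)$ the function $y\mapsto T_x\varphi(xy)$, $y\in\mathbb{R}_*^d$, extends to a $C^\infty$ function on $\mathbb{R}^d$. 2. If $\operatorname{supp}T\subset W_\varepsilon$ for some $\varepsilon>0$, then $T\in\mathscr{D}_H(\mathbb{R}^d)$. -/

import Mathlib

open MeasureTheory TopologicalSpace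
open scoped Distributions ContDiff

namespace HadamardDist

/-- The space `ℝ^d` with its Euclidean norm. -/
abbrev Rd (d : ℕ) : Type := EuclideanSpace ℝ (Fin d)

/-- The space `𝓓(ℝ^d)` of `𝕜`-valued test functions (`𝕜 = ℝ` or `ℂ`). -/
abbrev Test (d : ℕ) (𝕜 : Type*) [RCLike 𝕜] : Type _ := 𝓓((⊤ : Opens (Rd d)), 𝕜)

/-- The space `𝓓'(ℝ^d)` of distributions: continuous `𝕜`-linear forms on `𝓓(ℝ^d)`. -/
abbrev Distr (d : ℕ) (𝕜 : Type*) [RCLike 𝕜] : Type _ := Test d 𝕜 →L[𝕜] 𝕜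

/-- `W_ε = {x ∈ ℝ^d : min_j |x_j| ≥ ε}`. -/
def W (d : ℕ) (ε : ℝ) : Set (Rd d) := {x | ∀ j, ε ≤ |x j|}

/-- `(ℝ \ {0})^d`. -/
def nonzeroPart (d : ℕ) : Set (Rd d) := {y | ∀ j, y j ≠ 0}

/-- Coordinatewise multiplication `xy = (x_1 y_1, …, x_d y_d)`. -/
def coordProd {d : ℕ} (x y : Rd d) : Rd d := WithLp.toLp 2 fun j => x j * y j

theorem contDiff_coordProd_left {d : ℕ} (y : Rd d) :
    ContDiff ℝ ∞ fun x : Rd d => coordProd x y := by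
  rw [contDiff_euclidean]
  intro j
  exact (contDiff_piLp_apply (p := 2)).mul contDiff_const

/-- For `y ∈ (ℝ \ {0})^d`, multiplication by `y` as a homeomorphism of `ℝ^d`. -/
noncomputable def coordProdHomeo {d : ℕ} (y : Rd d) (hy : y ∈ nonzeroPart d) : Rd d ≃ₜ Rd d where
  toFun x := coordProd x y
  invFun x := coordProd x (WithLp.toLp 2 fun j => (y j)⁻¹)
  left_inv x := by
    ext j
    simp [coordProd, mul_assoc, mul_inv_cancel₀ (hy j)]
  right_inv x := by
    ext j
    simp [coordProd, mul_assoc, inv_mul_cancel₀ (hy j)]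
  continuous_toFun := (contDiff_coordProd_left _).continuous
  continuous_invFun := (contDiff_coordProd_left _).continuous

/-- For `y ∈ (ℝ \ {0})^d` and a test function `φ`, the test function `x ↦ φ (xy)`. -/
noncomputable def dilate {d : ℕ} {𝕜 : Type*} [RCLike 𝕜] (y : Rd d) (hy : y ∈ nonzeroPart d)
    (φ : Test d 𝕜) : Test d 𝕜 where
  toFun x := φ (coordProd x y)
  contDiff' := φ.contDiff.comp (contDiff_coordProd_left y)
  hasCompactSupport' := φ.hasCompactSupport.comp_homeomorph (coordProdHomeo y hy)
  tsupport_subset' := Set.subset_univ _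

theorem contDiff_coord {d : ℕ} (𝕜 : Type*) [RCLike 𝕜] (j : Fin d) :
    ContDiff ℝ ∞ fun x : Rd d => ((x j : ℝ) : 𝕜) :=
  (RCLike.ofRealCLM (K := 𝕜)).contDiff.comp (contDiff_piLp_apply (p := 2))

/-- Multiplication by the `j`-th coordinate, `φ ↦ x_j φ`, on test functions. -/
noncomputable def mulCoord {d : ℕ} (𝕜 : Type*) [RCLike 𝕜] (j : Fin d) :
    Test d 𝕜 →L[𝕜] Test d 𝕜 :=
  TestFunction.limitCLM 𝕜
    (fun φ =>
      { toFun := fun x => φ x * ((x j : ℝ) : 𝕜)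
        contDiff' := φ.contDiff.mul (contDiff_coord 𝕜 j)
        hasCompactSupport' := φ.hasCompactSupport.mul_right
        tsupport_subset' := Set.subset_univ _ })
    (fun _ hK => (TestFunction.ofSupportedInCLM 𝕜 hK).comp
      (ContDiffMapSupportedIn.bilinLeftCLM (ContinuousLinearMap.mul 𝕜 𝕜) (contDiff_coord 𝕜 j)))
    (fun _ _ _ => rfl)

/-- The partial derivative of a distribution: `(∂_j T) φ = - T (∂_j φ)`. -/
noncomputable def partialDeriv {d : ℕ} {𝕜 : Type*} [RCLike 𝕜] (j : Fin d) (T : Distr d 𝕜) :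
    Distr d 𝕜 :=
  -(T.comp (TestFunction.lineDerivCLM 𝕜 (EuclideanSpace.single j (1 : ℝ))))

/-- The product of a distribution with the `j`-th coordinate: `(x_j T) φ = T (x_j φ)`. -/
noncomputable def coordMul {d : ℕ} {𝕜 : Type*} [RCLike 𝕜] (j : Fin d) (T : Distr d 𝕜) :
    Distr d 𝕜 :=
  T.comp (mulCoord 𝕜 j)

/-- The Euler derivative `θ_j = x_j ∂_j` as a linear operator on distributions. -/
noncomputable def euler {d : ℕ} (𝕜 : Type*) [RCLike 𝕜] (j : Fin d) :
    Module.End 𝕜 (Distr d 𝕜) where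
  toFun T := coordMul j (partialDeriv j T)
  map_add' S T := by
    ext φ
    simp [coordMul, partialDeriv, add_comm]
  map_smul' c T := by
    ext φ
    simp [coordMul, partialDeriv]

/-- `θ^β = θ_1^{β_1} ⋯ θ_d^{β_d}` for a multi-index `β`. -/
noncomputable def eulerPow {d : ℕ} (𝕜 : Type*) [RCLike 𝕜] (β : Fin d → ℕ) :
    Module.End 𝕜 (Distr d 𝕜) :=
  (List.ofFn fun j => euler 𝕜 j ^ β j).prod

/-- The distribution `φ ↦ ∫ t(x) φ(x) dx` given by a locally integrable function `t` (by
convention it is `0` if `t` is not locally integrable). -/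
noncomputable def ofFun {d : ℕ} {𝕜 : Type*} [RCLike 𝕜] (t : Rd d → 𝕜) : Distr d 𝕜 :=
  TestFunction.integralAgainstBilinCLM (ContinuousLinearMap.mul 𝕜 𝕜) volume t

/-- The class `𝒪_H'`: for every `k` there are finitely many functions `t_β` with
`(1 + |x|²)^{k/2} t_β ∈ L_∞(ℝ^d)` and `T = ∑_β θ^β t_β`. -/
def OH (d : ℕ) (𝕜 : Type*) [RCLike 𝕜] : Set (Distr d 𝕜) :=
  {T | ∀ k : ℕ, ∃ (B : Finset (Fin d → ℕ)) (t : (Fin d → ℕ) → Rd d → 𝕜),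
    (∀ β ∈ B, MemLp (fun x => (1 + ‖x‖ ^ 2) ^ ((k : ℝ) / 2) • t β x) ⊤ volume) ∧
    T = ∑ β ∈ B, eulerPow 𝕜 β (ofFun (t β))}

/-- The class `𝓓_H`: for every test function `φ`, the function `y ↦ T_x φ(xy)` on
`(ℝ \ {0})^d` is the restriction of a test function. -/
def DH (d : ℕ) (𝕜 : Type*) [RCLike 𝕜] : Set (Distr d 𝕜) :=
  {T | ∀ φ : Test d 𝕜, ∃ ψ : Test d 𝕜,
    ∀ (y : Rd d) (hy : y ∈ nonzeroPart d), T (dilate y hy φ) = ψ y}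

end HadamardDist

namespace HadamardDist

section Vanishing

open scoped Manifold

variable {E : Type*} [NormedAddCommGroup E] [NormedSpace ℝ E] {𝕜 : Type*} [RCLike 𝕜]

/-- The product of a real smooth function and a test function. -/
noncomputable def smoothMul (χ : E → ℝ) (hχ : ContDiff ℝ ∞ χ) (f : 𝓓((⊤ : Opens E), 𝕜)) :
    𝓓((⊤ : Opens E), 𝕜) where
  toFun x := χ x • f x
  contDiff' := hχ.smul f.contDiff
  hasCompactSupport' := HasCompactSupport.smul_left (f := χ) (f' := f) f.hasCompactSupport
  tsupport_subset' := Set.subset_univ _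

/-- A distribution vanishes on the complement of its support. -/
theorem isVanishingOn_compl_dsupport [FiniteDimensional ℝ E]
    (T : 𝓓((⊤ : Opens E), 𝕜) →L[𝕜] 𝕜) :
    Distribution.IsVanishingOn T (Distribution.dsupport T : Set E)ᶜ := by
  intro f hf
  have hU : ∀ x : ((Distribution.dsupport T : Set E)ᶜ : Set E), ∃ s : Set E,
      Distribution.IsVanishingOn T s ∧ IsOpen s ∧ (x : E) ∈ s :=
    fun x => (Distribution.notMem_dsupport_iff _).1 x.2
  choose U hUv hUo hxU using hU
  obtain ⟨I, hI⟩ := f.hasCompactSupport.isCompact.elim_finite_subcover U hUo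
    fun x hx => Set.mem_iUnion.2 ⟨⟨x, hf hx⟩, hxU _⟩
  obtain ⟨ρ, hρ⟩ := SmoothPartitionOfUnity.exists_isSubordinate 𝓘(ℝ, E) (isClosed_tsupport f)
    (fun i : I => U i) (fun i => hUo i) (by simpa [Set.iUnion_subtype] using hI)
  have hsmooth : ∀ i, ContDiff ℝ ∞ (ρ i) := fun i => (ρ i).contMDiff.contDiff
  have hsum : f = ∑ i, smoothMul (ρ i) (hsmooth i) f := by
    ext x
    let ev : 𝓓((⊤ : Opens E), 𝕜) →+ 𝕜 := ⟨⟨fun g => g x, rfl⟩, fun _ _ => rfl⟩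
    change f x = ev (∑ i, smoothMul (ρ i) (hsmooth i) f)
    rw [map_sum]
    change f x = ∑ i, ρ i x • f x
    rw [← Finset.sum_smul]
    by_cases hx : x ∈ tsupport f
    · rw [← finsum_eq_sum_of_fintype, ρ.sum_eq_one hx, one_smul]
    · rw [image_eq_zero_of_notMem_tsupport hx, smul_zero]
  rw [hsum, map_sum]
  refine Finset.sum_eq_zero fun i _ => hUv i _ ?_
  exact (tsupport_smul_subset_left _ _).trans (hρ i)

end Vanishing

variable {d : ℕ} {𝕜 : Type*} [RCLike 𝕜]

@[simp]
theorem dilate_apply (y : Rd d) (hy : y ∈ nonzeroPart d) (φ : Test d 𝕜) (x : Rd d) :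
    dilate y hy φ x = φ (coordProd x y) :=
  rfl

theorem coordProd_comm (x y : Rd d) : coordProd x y = coordProd y x := by
  ext j
  simp [coordProd, mul_comm]

/-- Multiplication by `x` as a continuous linear map. -/
noncomputable def coordProdCLM (x : Rd d) : Rd d →L[ℝ] Rd d :=
  ∑ j, (EuclideanSpace.proj j : Rd d →L[ℝ] ℝ).smulRight (EuclideanSpace.single j (x j))

theorem coordProdCLM_apply (x y : Rd d) : coordProdCLM x y = coordProd x y := by
  ext j
  simp [coordProdCLM, coordProd, Pi.single_apply, mul_comm]

/-- The partial derivatives of a test function. -/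
noncomputable def partialTest (j : Fin d) (φ : Test d 𝕜) : Test d 𝕜 :=
  TestFunction.lineDerivCLM 𝕜 (EuclideanSpace.single j (1 : ℝ)) φ

theorem partialTest_apply (j : Fin d) (φ : Test d 𝕜) (x : Rd d) :
    partialTest j φ x = fderiv ℝ φ x (EuclideanSpace.single j 1) := by
  have : DifferentiableAt ℝ φ x := (φ.contDiff.differentiable (by simp)).differentiableAt
  rw [partialTest, TestFunction.lineDerivCLM_apply_of_le le_top, this.lineDeriv_eq_fderiv]

/-- The coordinate functionals, with values in `𝕜`. -/
noncomputable def coordCLM (𝕜 : Type*) [RCLike 𝕜] (j : Fin d) : Rd d →L[ℝ] 𝕜 :=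
  (RCLike.ofRealCLM (K := 𝕜)).comp (EuclideanSpace.proj j)

theorem coordCLM_apply (j : Fin d) (y : Rd d) : coordCLM 𝕜 j y = ((y j : ℝ) : 𝕜) :=
  rfl

theorem hasFDerivAt_comp_coordProd (φ : Test d 𝕜) (x y : Rd d) :
    HasFDerivAt (fun y => φ (coordProd x y))
      (∑ j, (((x j : ℝ) : 𝕜) * partialTest j φ (coordProd x y)) • coordCLM 𝕜 j) y := by
  have h1 : HasFDerivAt (fun y => coordProd x y) (coordProdCLM x) y := by
    simpa only [← coordProdCLM_apply] using (coordProdCLM x).hasFDerivAt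
  have h2 : HasFDerivAt φ (fderiv ℝ φ (coordProd x y)) (coordProd x y) :=
    (φ.contDiff.differentiable (by simp)).differentiableAt.hasFDerivAt
  refine (h2.comp y h1).congr_fderiv ?_
  ext v
  simp only [coordProdCLM, ContinuousLinearMap.comp_apply, sum_apply, map_sum,
    ContinuousLinearMap.smulRight_apply, smul_apply, map_smul, coordCLM_apply,
    partialTest_apply]
  refine Finset.sum_congr rfl fun j _ => ?_
  have : EuclideanSpace.single j (x j) = (x j) • EuclideanSpace.single j (1 : ℝ) := by
    ext i
    simp
  rw [this, map_smul]
  have hproj : (EuclideanSpace.proj j : Rd d →L[ℝ] ℝ) v = v j := rfl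
  simp only [hproj, RCLike.real_smul_eq_coe_mul, smul_eq_mul]
  ring

theorem exists_norm_le (φ : Test d 𝕜) : ∃ C, ∀ x, ‖φ x‖ ≤ C :=
  φ.hasCompactSupport.exists_bound_of_continuous φ.continuous

theorem continuous_comp_coordProd (φ : Test d 𝕜) (y : Rd d) :
    Continuous fun x => φ (coordProd x y) :=
  φ.continuous.comp (contDiff_coordProd_left y).continuous

theorem integrable_mul_comp_coordProd {t : Rd d → 𝕜} (ht : Integrable t) (φ : Test d 𝕜)
    (y : Rd d) : Integrable fun x => t x * φ (coordProd x y) := by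
  obtain ⟨C, hC⟩ := exists_norm_le φ
  exact ht.mul_bdd (continuous_comp_coordProd φ y).aestronglyMeasurable
    (Filter.Eventually.of_forall fun x => hC _)

theorem continuous_integral_mul_comp_coordProd {t : Rd d → 𝕜} (ht : Integrable t) (φ : Test d 𝕜) :
    Continuous fun y => ∫ x, t x * φ (coordProd x y) := by
  obtain ⟨C, hC⟩ := exists_norm_le φ
  refine continuous_of_dominated (bound := fun x => ‖t x‖ * C)
    (fun y => (integrable_mul_comp_coordProd ht φ y).aestronglyMeasurable)
    (fun y => Filter.Eventually.of_forall fun x => ?_) (ht.norm.mul_const C)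
    (Filter.Eventually.of_forall fun x => ?_)
  · rw [norm_mul]
    gcongr
    exact hC _
  · have hc : Continuous fun y => coordProd x y := by
      simpa only [coordProd_comm x] using (contDiff_coordProd_left x).continuous
    exact continuous_const.mul (φ.continuous.comp hc)

theorem hasFDerivAt_integral_mul_comp_coordProd {t : Rd d → 𝕜} (ht : Integrable t)
    (ht' : ∀ j, Integrable fun x => t x * ((x j : ℝ) : 𝕜)) (φ : Test d 𝕜) (y : Rd d) :
    HasFDerivAt (fun y => ∫ x, t x * φ (coordProd x y))
      (∑ j, (∫ x, t x * ((x j : ℝ) : 𝕜) * partialTest j φ (coordProd x y)) • coordCLM 𝕜 j) y := by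
  let F' : Rd d → Rd d → Rd d →L[ℝ] 𝕜 := fun y x => ∑ j,
    (t x * ((x j : ℝ) : 𝕜) * partialTest j φ (coordProd x y)) • coordCLM 𝕜 j
  have hint : ∀ y j, Integrable fun x =>
      (t x * ((x j : ℝ) : 𝕜) * partialTest j φ (coordProd x y)) • coordCLM (d := d) 𝕜 j :=
    fun y j => (integrable_mul_comp_coordProd (ht' j) (partialTest j φ) y).smul_const _
  have hF'int : Integrable (F' y) :=
    integrable_finsetSum (ε' := Rd d →L[ℝ] 𝕜) Finset.univ (f := fun j x =>
      (t x * ((x j : ℝ) : 𝕜) * partialTest j φ (coordProd x y)) • coordCLM (d := d) 𝕜 j)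
      fun j _ => hint y j
  choose C hC using fun j => exists_norm_le (partialTest (d := d) (𝕜 := 𝕜) j φ)
  have hbound : ∀ x y, ‖F' y x‖ ≤
      ∑ j, ‖t x * ((x j : ℝ) : 𝕜)‖ * C j * ‖coordCLM (d := d) 𝕜 j‖ := by
    intro x y
    refine (norm_sum_le _ _).trans (Finset.sum_le_sum fun j _ => ?_)
    rw [norm_smul, norm_mul]
    gcongr
    exact hC j _
  have hbint : Integrable fun x : Rd d =>
      ∑ j, ‖t x * ((x j : ℝ) : 𝕜)‖ * C j * ‖coordCLM (d := d) 𝕜 j‖ :=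
    integrable_finsetSum _ fun j _ => ((ht' j).norm.mul_const _).mul_const _
  have hderiv : ∀ x y, HasFDerivAt (fun y => t x * φ (coordProd x y)) (F' y x) y := by
    intro x y
    refine ((hasFDerivAt_comp_coordProd φ x y).const_mul (t x)).congr_fderiv ?_
    simp_rw [F', Finset.smul_sum, smul_smul, mul_assoc]
  have hvalue : ∫ x, F' y x =
      ∑ j, (∫ x, t x * ((x j : ℝ) : 𝕜) * partialTest j φ (coordProd x y)) • coordCLM 𝕜 j := by
    rw [integral_finsetSum _ fun j _ => hint y j]
    simp_rw [integral_smul_const]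
  rw [← hvalue]
  exact hasFDerivAt_integral_of_dominated_of_fderiv_le Filter.univ_mem
    (Filter.Eventually.of_forall fun y =>
      (integrable_mul_comp_coordProd ht φ y).aestronglyMeasurable)
    (integrable_mul_comp_coordProd ht φ y) hF'int.aestronglyMeasurable
    (Filter.Eventually.of_forall fun x y _ => hbound x y) hbint
    (Filter.Eventually.of_forall fun x y _ => hderiv x y)

theorem contDiff_integral_mul_comp_coordProd (n : ℕ) : ∀ {t : Rd d → 𝕜},
    AEStronglyMeasurable t → (Integrable fun x => (1 + ‖x‖) ^ n * ‖t x‖) → ∀ φ : Test d 𝕜,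
      ContDiff ℝ n fun y => ∫ x, t x * φ (coordProd x y) := by
  have hcoord : ∀ j : Fin d, Continuous fun x : Rd d => ((x j : ℝ) : 𝕜) :=
    fun j => (contDiff_coord 𝕜 j).continuous
  induction n with
  | zero =>
    intro t htm ht φ
    simp only [pow_zero, one_mul] at ht
    exact contDiff_zero.2
      (continuous_integral_mul_comp_coordProd ((integrable_norm_iff htm).1 ht) φ)
  | succ n ih =>
    intro t htm ht φ
    have hti : Integrable t := by
      refine ht.mono' htm (Filter.Eventually.of_forall fun x => ?_)
      refine le_mul_of_one_le_left (norm_nonneg _) (one_le_pow₀ ?_)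
      linarith [norm_nonneg x]
    have htm' : ∀ j, AEStronglyMeasurable fun x => t x * ((x j : ℝ) : 𝕜) :=
      fun j => htm.mul (hcoord j).aestronglyMeasurable
    have hle : ∀ (j : Fin d) (x : Rd d), ‖t x * ((x j : ℝ) : 𝕜)‖ ≤ (1 + ‖x‖) * ‖t x‖ := by
      intro j x
      rw [norm_mul, RCLike.norm_ofReal, mul_comm]
      gcongr
      have := PiLp.norm_apply_le x j
      rw [Real.norm_eq_abs] at this
      linarith
    have ht' : ∀ j, Integrable fun x => (1 + ‖x‖) ^ n * ‖t x * ((x j : ℝ) : 𝕜)‖ := by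
      intro j
      refine ht.mono' (AEStronglyMeasurable.mul (by fun_prop) (htm' j).norm)
        (Filter.Eventually.of_forall fun x => ?_)
      rw [Real.norm_of_nonneg (by positivity), pow_succ, mul_assoc]
      gcongr
      exact hle j x
    have hti' : ∀ j, Integrable fun x => t x * ((x j : ℝ) : 𝕜) := by
      intro j
      refine (ht' j).mono' (htm' j) (Filter.Eventually.of_forall fun x => ?_)
      refine le_mul_of_one_le_left (norm_nonneg _) (one_le_pow₀ ?_)
      linarith [norm_nonneg x]
    have hd := hasFDerivAt_integral_mul_comp_coordProd hti hti' φ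
    push_cast
    refine contDiff_succ_iff_fderiv.2 ⟨fun y => (hd y).differentiableAt, by simp, ?_⟩
    rw [funext fun y => (hd y).fderiv]
    exact ContDiff.sum fun j _ => (ih (htm' j) (ht' j) (partialTest j φ)).smul contDiff_const

/-- The formal adjoint `φ ↦ -∂_j (x_j φ)` of the Euler derivative. -/
noncomputable def eulerAdjoint (j : Fin d) (φ : Test d 𝕜) : Test d 𝕜 :=
  -partialTest j (mulCoord 𝕜 j φ)

theorem euler_apply (j : Fin d) (T : Distr d 𝕜) (φ : Test d 𝕜) :
    euler 𝕜 j T φ = T (eulerAdjoint j φ) := by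
  simp [euler, coordMul, partialDeriv, eulerAdjoint, partialTest]

theorem eulerAdjoint_apply (j : Fin d) (φ : Test d 𝕜) (x : Rd d) :
    eulerAdjoint j φ x = -(φ x + ((x j : ℝ) : 𝕜) * partialTest j φ x) := by
  have h1 : HasFDerivAt φ (fderiv ℝ φ x) x :=
    (φ.contDiff.differentiable (by simp)).differentiableAt.hasFDerivAt
  have h2 : HasFDerivAt (mulCoord 𝕜 j φ) _ x := h1.mul (coordCLM 𝕜 j).hasFDerivAt
  change -(partialTest j (mulCoord 𝕜 j φ) x) = _
  rw [partialTest_apply, h2.fderiv, partialTest_apply]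
  simp [coordCLM_apply]

theorem partialTest_dilate (j : Fin d) (y : Rd d) (hy : y ∈ nonzeroPart d) (φ : Test d 𝕜)
    (x : Rd d) :
    partialTest j (dilate y hy φ) x = ((y j : ℝ) : 𝕜) * dilate y hy (partialTest j φ) x := by
  have h' : HasFDerivAt (dilate y hy φ)
      (∑ j, (((y j : ℝ) : 𝕜) * partialTest j φ (coordProd x y)) • coordCLM 𝕜 j) x := by
    have h := hasFDerivAt_comp_coordProd φ y x
    simp only [coordProd_comm y] at h
    exact h
  rw [partialTest_apply, h'.fderiv, sum_apply, Finset.sum_eq_single j]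
  · simp [coordCLM_apply]
  · intro i _ hij
    simp [coordCLM_apply, hij]
  · simp

theorem eulerAdjoint_dilate (j : Fin d) (y : Rd d) (hy : y ∈ nonzeroPart d) (φ : Test d 𝕜) :
    eulerAdjoint j (dilate y hy φ) = dilate y hy (eulerAdjoint j φ) := by
  ext x
  rw [dilate_apply, eulerAdjoint_apply, eulerAdjoint_apply, partialTest_dilate]
  simp only [dilate_apply, coordProd, RCLike.ofReal_mul]
  ring

/-- The operators on distributions that are transposes of maps of test functions commuting with
dilations. -/
def dilationInvariant (d : ℕ) (𝕜 : Type*) [RCLike 𝕜] : Submonoid (Module.End 𝕜 (Distr d 𝕜)) where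
  carrier := {S | ∃ A : Test d 𝕜 → Test d 𝕜, (∀ T φ, S T φ = T (A φ)) ∧
    ∀ y hy φ, A (dilate y hy φ) = dilate y hy (A φ)}
  one_mem' := ⟨id, fun _ _ => rfl, fun _ _ _ => rfl⟩
  mul_mem' := by
    rintro S S' ⟨A, hA, hA'⟩ ⟨B, hB, hB'⟩
    refine ⟨fun φ => B (A φ), fun T φ => ?_, fun y hy φ => ?_⟩
    · rw [Module.End.mul_apply, hA, hB]
    · change B (A (dilate y hy φ)) = _
      rw [hA', hB']

theorem eulerPow_mem_dilationInvariant (β : Fin d → ℕ) :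
    eulerPow 𝕜 β ∈ dilationInvariant d 𝕜 := by
  refine Submonoid.list_prod_mem _ fun S hS => ?_
  obtain ⟨j, rfl⟩ := List.mem_ofFn.1 hS
  exact pow_mem (show euler 𝕜 j ∈ dilationInvariant d 𝕜 from
    ⟨eulerAdjoint j, euler_apply j, eulerAdjoint_dilate j⟩) _

theorem ofFun_apply {t : Rd d → 𝕜} (ht : Integrable t) (φ : Test d 𝕜) :
    ofFun t φ = ∫ x, t x * φ x := by
  rw [ofFun, TestFunction.integralAgainstBilinCLM_eq_integral
    (ht.locallyIntegrable.locallyIntegrableOn _)]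
  simp [mul_comm]

theorem aestronglyMeasurable_of_weighted {s : ℝ} {t : Rd d → 𝕜}
    (ht : AEStronglyMeasurable fun x => (1 + ‖x‖ ^ 2) ^ s • t x) : AEStronglyMeasurable t := by
  have hw : AEStronglyMeasurable (fun x : Rd d => (1 + ‖x‖ ^ 2) ^ (-s)) :=
    (Measurable.pow_const (by fun_prop) _).aestronglyMeasurable
  refine (hw.smul ht).congr (Filter.Eventually.of_forall fun x => ?_)
  have : (0 : ℝ) < 1 + ‖x‖ ^ 2 := by positivity
  simp only [Pi.smul_apply', smul_smul]
  rw [← Real.rpow_add this, neg_add_cancel, Real.rpow_zero, one_smul]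

theorem integrable_pow_mul_norm_of_weighted (n : ℕ) {t : Rd d → 𝕜}
    (ht : MemLp (fun x => (1 + ‖x‖ ^ 2) ^ (((2 * n + (d + 1) : ℕ) : ℝ) / 2) • t x) ⊤ volume) :
    Integrable fun x => (1 + ‖x‖) ^ n * ‖t x‖ := by
  have htm := aestronglyMeasurable_of_weighted ht.aestronglyMeasurable
  have hint : Integrable fun x : Rd d => (1 + ‖x‖ ^ 2) ^ (-((d : ℝ) + 1) / 2) :=
    integrable_rpow_neg_one_add_norm_sq (by simp)
  set K := eLpNorm (fun x => (1 + ‖x‖ ^ 2) ^ (((2 * n + (d + 1) : ℕ) : ℝ) / 2) • t x) ⊤ volume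
    with hK
  have hbound : ∀ᵐ x, ‖(1 + ‖x‖ ^ 2) ^ (((2 * n + (d + 1) : ℕ) : ℝ) / 2) • t x‖ ≤ K.toReal := by
    rw [eLpNorm_exponent_top] at hK
    filter_upwards [ae_le_eLpNormEssSup (μ := volume)
      (f := fun x => (1 + ‖x‖ ^ 2) ^ (((2 * n + (d + 1) : ℕ) : ℝ) / 2) • t x)] with x hx
    rw [← hK] at hx
    simpa only [toReal_enorm] using ENNReal.toReal_mono ht.2.ne hx
  refine (hint.const_mul (2 ^ n * K.toReal)).mono'
    (AEStronglyMeasurable.mul (by fun_prop) htm.norm) ?_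
  filter_upwards [hbound] with x hx
  have hpos : (0 : ℝ) < 1 + ‖x‖ ^ 2 := by positivity
  rw [norm_smul, Real.norm_of_nonneg (by positivity)] at hx
  rw [Real.norm_of_nonneg (by positivity)]
  have hpow : (1 + ‖x‖) ^ n ≤ 2 ^ n * (1 + ‖x‖ ^ 2) ^ n := by
    rw [← mul_pow]
    gcongr
    nlinarith [sq_nonneg (‖x‖ - 1 / 2)]
  have hsplit : (1 + ‖x‖ ^ 2) ^ n = (1 + ‖x‖ ^ 2) ^ (((2 * n + (d + 1) : ℕ) : ℝ) / 2) *
      (1 + ‖x‖ ^ 2) ^ (-((d : ℝ) + 1) / 2) := by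
    rw [← Real.rpow_add hpos, ← Real.rpow_natCast]
    congr 1
    push_cast
    ring
  calc (1 + ‖x‖) ^ n * ‖t x‖ ≤ 2 ^ n * (1 + ‖x‖ ^ 2) ^ n * ‖t x‖ := by gcongr
    _ = 2 ^ n * ((1 + ‖x‖ ^ 2) ^ (((2 * n + (d + 1) : ℕ) : ℝ) / 2) * ‖t x‖) *
        (1 + ‖x‖ ^ 2) ^ (-((d : ℝ) + 1) / 2) := by
      rw [hsplit]
      ring
    _ ≤ 2 ^ n * K.toReal * (1 + ‖x‖ ^ 2) ^ (-((d : ℝ) + 1) / 2) := by gcongr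

theorem dense_nonzeroPart : Dense (nonzeroPart d) := by
  have h : Dense (Set.pi Set.univ fun _ : Fin d => ({0}ᶜ : Set ℝ)) :=
    dense_pi _ fun _ _ => dense_compl_singleton 0
  have h2 := h.preimage (EuclideanSpace.equiv (Fin d) ℝ).toHomeomorph.isOpenMap
  convert h2 using 1
  ext y
  simp [nonzeroPart]

theorem exists_contDiff_nat {T : Distr d 𝕜} (hT : T ∈ OH d 𝕜) (φ : Test d 𝕜) (n : ℕ) :
    ∃ F : Rd d → 𝕜, ContDiff ℝ n F ∧
      ∀ (y : Rd d) (hy : y ∈ nonzeroPart d), T (dilate y hy φ) = F y := by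
  obtain ⟨B, t, ht, rfl⟩ := hT (2 * n + (d + 1))
  choose A hA hA' using fun β => eulerPow_mem_dilationInvariant (d := d) (𝕜 := 𝕜) β
  have htm : ∀ β ∈ B, AEStronglyMeasurable (t β) := fun β hβ =>
    aestronglyMeasurable_of_weighted (ht β hβ).aestronglyMeasurable
  have htn : ∀ β ∈ B, Integrable fun x => (1 + ‖x‖) ^ n * ‖t β x‖ := fun β hβ =>
    integrable_pow_mul_norm_of_weighted n (ht β hβ)
  have hti : ∀ β ∈ B, Integrable (t β) := by
    intro β hβ
    refine (htn β hβ).mono' (htm β hβ) (Filter.Eventually.of_forall fun x => ?_)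
    refine le_mul_of_one_le_left (norm_nonneg _) (one_le_pow₀ ?_)
    linarith [norm_nonneg x]
  refine ⟨fun y => ∑ β ∈ B, ∫ x, t β x * A β φ (coordProd x y), ContDiff.sum fun β hβ =>
    contDiff_integral_mul_comp_coordProd n (htm β hβ) (htn β hβ) _, fun y hy => ?_⟩
  rw [sum_apply]
  refine Finset.sum_congr rfl fun β hβ => ?_
  rw [hA, hA', ofFun_apply (hti β hβ)]
  rfl

theorem exists_contDiff {T : Distr d 𝕜} (hT : T ∈ OH d 𝕜) (φ : Test d 𝕜) :
    ∃ F : Rd d → 𝕜, ContDiff ℝ ∞ F ∧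
      ∀ (y : Rd d) (hy : y ∈ nonzeroPart d), T (dilate y hy φ) = F y := by
  choose F hF hTF using exists_contDiff_nat hT φ
  refine ⟨F 0, contDiff_infty.2 fun n => ?_, hTF 0⟩
  rw [(hF 0).continuous.ext_on dense_nonzeroPart (hF n).continuous
    fun y hy => (hTF 0 y hy).symm.trans (hTF n y hy)]
  exact hF n

theorem dilate_eq_zero {T : Distr d 𝕜} {ε : ℝ} (hT : Distribution.dsupport T ⊆ W d ε)
    {φ : Test d 𝕜} {R : ℝ} (hφ : ∀ x, φ x ≠ 0 → ‖x‖ ≤ R) {y : Rd d} (hy : y ∈ nonzeroPart d)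
    {j : Fin d} (hj : R < ε * |y j|) : T (dilate y hy φ) = 0 := by
  refine isVanishingOn_compl_dsupport T _ fun x hx hxT => ?_
  have hclosed : IsClosed {x : Rd d | |x j| * |y j| ≤ R} :=
    isClosed_le (by fun_prop) continuous_const
  have hsub : Function.support (dilate y hy φ) ⊆ {x : Rd d | |x j| * |y j| ≤ R} := by
    intro x hx
    have h1 := hφ _ hx
    have h2 := PiLp.norm_apply_le (coordProd x y) j
    rw [coordProd, Real.norm_eq_abs, PiLp.toLp_apply, abs_mul] at h2
    exact h2.trans h1
  have h3 : |x j| * |y j| ≤ R := closure_minimal hsub hclosed hx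
  have h4 : ε * |y j| ≤ |x j| * |y j| := by
    gcongr
    exact hT hxT j
  linarith

theorem mem_DH {T : Distr d 𝕜} (hT : T ∈ OH d 𝕜) {ε : ℝ} (hε : 0 < ε)
    (hsupp : Distribution.dsupport T ⊆ W d ε) : T ∈ DH d 𝕜 := by
  intro φ
  obtain ⟨F, hF, hTF⟩ := exists_contDiff hT φ
  obtain ⟨R, hR⟩ := φ.hasCompactSupport.isCompact.isBounded.exists_norm_le
  have hφ : ∀ x, φ x ≠ 0 → ‖x‖ ≤ R := fun x hx => hR x (subset_tsupport _ hx)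
  have hzero : ∀ y j, R < ε * |y j| → F y = 0 := by
    intro y j hy
    have hopen : IsOpen {y : Rd d | R < ε * |y j|} := isOpen_lt continuous_const (by fun_prop)
    have hmem : y ∈ closure ({y : Rd d | R < ε * |y j|} ∩ nonzeroPart d) :=
      dense_nonzeroPart.open_subset_closure_inter hopen hy
    refine closure_minimal (t := {y | F y = 0}) (fun z hz => ?_)
      (isClosed_eq hF.continuous continuous_const) hmem
    exact (hTF z hz.2).symm.trans (dilate_eq_zero hsupp hφ hz.2 hz.1)
  have hFc : HasCompactSupport F := by
    refine HasCompactSupport.intro (K := (EuclideanSpace.equiv (Fin d) ℝ) ⁻¹'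
      Set.pi Set.univ fun _ => Set.Icc (-(R / ε)) (R / ε)) ?_ fun y hy => ?_
    · exact (EuclideanSpace.equiv (Fin d) ℝ).toHomeomorph.isCompact_preimage.2
        (isCompact_univ_pi fun _ => isCompact_Icc)
    · by_contra h
      refine hy fun j _ => abs_le.1 ?_
      rw [le_div_iff₀' hε]
      exact not_lt.1 fun hj => h (hzero y j hj)
  exact ⟨⟨F, hF, hFc, Set.subset_univ _⟩, hTF⟩

end HadamardDist

theorem theorem2p6 (d : ℕ) (𝕜 : Type*) [RCLike 𝕜] (T : HadamardDist.Distr d 𝕜)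
    (hT : T ∈ HadamardDist.OH d 𝕜) :
    (∀ φ : HadamardDist.Test d 𝕜, ∃ F : HadamardDist.Rd d → 𝕜, ContDiff ℝ ∞ F ∧
      ∀ (y : HadamardDist.Rd d) (hy : y ∈ HadamardDist.nonzeroPart d),
        T (HadamardDist.dilate y hy φ) = F y) ∧
    ((∃ ε : ℝ, 0 < ε ∧ Distribution.dsupport T ⊆ HadamardDist.W d ε) →
      T ∈ HadamardDist.DH d 𝕜) := by
  refine ⟨HadamardDist.exists_contDiff hT, ?_⟩
  rintro ⟨ε, hε, hsupp⟩
  exact HadamardDist.mem_DH hT hε hsupp
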